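/- **Conventions.** Simplicial complexes are realized with the length metric in which every simplex is a regular Euclidean simplex of side $1$; balls $B(x,r)$ are closed. A map $f\colon X\to Y$ of metric spaces is *regular* if for some $\kappa\ge 1$ one has $d_Y(f(x),f(x'))\le \kappa\, d_X(x,x')+\kappa$ for all $x,x'\in X$, and for every $y\in Y$ the set $f^{-1}(B_Y(y,1))$ is covered by at most $\kappa$ balls of radius $1$. It is a *quasi-isometry* if for some $\kappa\ge1$, $\varepsilon\ge0$ one has $\frac1\kappa d_X(x,x')-\varepsilon\le d_Y(f(x),f(x'))\le\kappa\, d_X(x,x')+\varepsilon$ for all $x,x'\in X$, and every point of $Y$ is within distance $\varepsilon$ of $f(X)$. Let $X$ be a connected simplicial complex of dimension at most $2$ and of bounded geometry (the number of simplices containing a given vertex is uniformly bounded). Let $P$ be a triangulation of the hyperbolic plane $\mathbb H^2$, i.e. a simplicial complex whose realization is identified with $\mathbb H^2$ by a homeomorphism; distances in $P$ are hyperbolic distances. Let $f\colon X\to P$ be a simplicial map (it may collapse simplices). * The *width* of $f$ is $\mathrm{width}(f)=\sup_{v\in V(P)}|\{u\in V(X): f(u)=v\}|$. The map $f$ is *width-visible*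 if there is $R>0$ such that for every $x\in V(X)$ there are $k=\mathrm{width}(f)<\infty$ pairwise distinct vertices $y_1,\dots,y_k\in B_X(x,R)$ with $f(y_1)=\dots=f(y_k)$. * For $\varepsilon>0$ and $x_0\in X$, an *$\varepsilon$-local modification* of $f$ at $x_0$ is a continuous (not necessarily simplicial) map $f'\colon X\to P$ with $f'=f$ on $X\setminus B_X(x_0,\varepsilon)$. The map $f$ is *very stable* if there is a point $x_0\in X$ such that, for every $\varepsilon>0$ and every $\varepsilon$-local modification $f'$ of $f$ at $x_0$, one has $f(x_0)\in f'(X)$. **Theorem.** If $f$ is regular, width-visible and very stable, then $f$ is a quasi-isometry from $X$ to $\mathbb H^2$. -/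

import Mathlib

open scoped NNReal ENNReal

noncomputable section

universe u v

/-! ### Geometric realizations of abstract simplicial complexes -/

namespace AbstractSimplicialComplex

/-- The geometric realization of `K`: formal convex combinations of vertices (barycentric
coordinates) whose support is a simplex of `K`. -/
@[ext]
structure Realization {V : Type u} (K : AbstractSimplicialComplex V) where
  /-- the barycentric coordinates of the point -/
  coord : V →₀ ℝ
  nonneg : ∀ a, 0 ≤ coord a
  sum_eq_one : coord.sum (fun _ r => r) = 1
  support_mem : coord.support ∈ K

variable {V : Type u} {W : Type v}

/-- The point of the realization given by a vertex. -/
def vertex (K : AbstractSimplicialComplex V) (a : V) : K.Realization where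
  coord := Finsupp.single a 1
  nonneg b := by
    classical
    rw [Finsupp.single_apply]
    split_ifs <;> norm_num
  sum_eq_one := by simp
  support_mem := by
    rw [Finsupp.support_single a (one_ne_zero (α := ℝ))]
    exact K.singleton_mem a

namespace Realization

variable {K : AbstractSimplicialComplex V}

/-- Two points lie in a common closed simplex. -/
def InCommonSimplex (x y : K.Realization) : Prop :=
  ∃ s ∈ K, x.coord.support ⊆ s ∧ y.coord.support ⊆ s

/-- The Euclidean distance in barycentric coordinates, scaled so that distinct vertices are at
distance `1`. On each simplex it is the metric of a regular Euclidean simplex of side `1`. -/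
def simplexDist (x y : K.Realization) : ℝ :=
  Real.sqrt ((x.coord - y.coord).sum (fun _ r => r ^ 2) / 2)

/-- `IsString x y ℓ`: there is a finite sequence of points from `x` to `y`, consecutive ones lying
in a common simplex, whose consecutive distances (measured in these simplices) add up to `ℓ`. -/
inductive IsString : K.Realization → K.Realization → ℝ≥0∞ → Prop
  | nil (x : K.Realization) : IsString x x 0
  | cons {x y z : K.Realization} {l : ℝ≥0∞} (h : InCommonSimplex x y) (hl : IsString y z l) :
      IsString x z (ENNReal.ofReal (simplexDist x y) + l)

/-- The length (extended) distance on the realization: the infimum of the lengths of strings, so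
every simplex is a regular Euclidean simplex of side `1`. It is infinite exactly between different
components. -/
instance : EDist K.Realization where
  edist x y := sInf {l | IsString x y l}

theorem edist_def (x y : K.Realization) : edist x y = sInf {l | IsString x y l} := rfl

theorem InCommonSimplex.symm {x y : K.Realization} (h : InCommonSimplex x y) :
    InCommonSimplex y x := by
  obtain ⟨s, hs, h1, h2⟩ := h
  exact ⟨s, hs, h2, h1⟩

theorem simplexDist_comm (x y : K.Realization) : simplexDist x y = simplexDist y x := by
  unfold simplexDist
  rw [← neg_sub y.coord x.coord, Finsupp.sum_neg_index (by intro; simp)]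
  simp

theorem IsString.trans {x y z : K.Realization} {l m : ℝ≥0∞} (h : IsString x y l)
    (h' : IsString y z m) : IsString x z (l + m) := by
  induction h with
  | nil x => simpa using h'
  | cons hc _ ih =>
    rw [add_assoc]
    exact IsString.cons hc (ih h')

theorem IsString.symm {x y : K.Realization} {l : ℝ≥0∞} (h : IsString x y l) :
    IsString y x l := by
  induction h with
  | nil x => exact IsString.nil x
  | @cons x y z l hc _ ih =>
    have h1 : IsString y x (ENNReal.ofReal (simplexDist y x) + 0) :=
      IsString.cons hc.symm (IsString.nil x)
    rw [add_zero, simplexDist_comm] at h1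
    rw [add_comm]
    exact ih.trans h1

theorem abs_coord_sub_le (x y : K.Realization) (a : V) :
    |x.coord a - y.coord a| ≤ 2 * simplexDist x y := by
  have h : (x.coord a - y.coord a) ^ 2 ≤ (x.coord - y.coord).sum (fun _ r => r ^ 2) := by
    by_cases ha : a ∈ (x.coord - y.coord).support
    · exact Finset.single_le_sum (f := fun b => ((x.coord - y.coord) b) ^ 2)
        (fun b _ => sq_nonneg _) ha
    · have h0 : x.coord a - y.coord a = 0 := by
        simpa using Finsupp.notMem_support_iff.mp ha
      rw [h0]
      rw [zero_pow two_ne_zero]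
      exact Finset.sum_nonneg (fun b _ => sq_nonneg ((x.coord - y.coord) b))
  refine abs_le_of_sq_le_sq ?_ (by unfold simplexDist; positivity)
  unfold simplexDist
  have hn := (sq_nonneg _).trans h
  rw [mul_pow, Real.sq_sqrt (by positivity)]
  linarith

theorem IsString.le_length {x y : K.Realization} {l : ℝ≥0∞} (h : IsString x y l) (a : V) :
    ENNReal.ofReal |x.coord a - y.coord a| ≤ 2 * l := by
  induction h with
  | nil x => simp
  | @cons x y z l hc _ ih =>
    calc ENNReal.ofReal |x.coord a - z.coord a|
        ≤ ENNReal.ofReal (|x.coord a - y.coord a| + |y.coord a - z.coord a|) :=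
          ENNReal.ofReal_le_ofReal (abs_sub_le _ _ _)
      _ = ENNReal.ofReal |x.coord a - y.coord a| + ENNReal.ofReal |y.coord a - z.coord a| :=
          ENNReal.ofReal_add (abs_nonneg _) (abs_nonneg _)
      _ ≤ ENNReal.ofReal (2 * simplexDist x y) + 2 * l :=
          add_le_add (ENNReal.ofReal_le_ofReal (abs_coord_sub_le x y a)) ih
      _ = 2 * (ENNReal.ofReal (simplexDist x y) + l) := by
          rw [ENNReal.ofReal_mul (by norm_num), mul_add]
          simp

/-- The realization with the length metric, and with the topology of that metric. -/
instance : EMetricSpace K.Realization where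
  edist_self x := le_antisymm (sInf_le (IsString.nil x)) bot_le
  edist_comm x y := by
    rw [edist_def, edist_def]
    congr 1
    ext l
    exact ⟨IsString.symm, IsString.symm⟩
  edist_triangle x y z := by
    rw [edist_def x y, edist_def y z, ENNReal.sInf_add]
    refine le_iInf₂ fun l hl => ?_
    rw [add_comm, ENNReal.sInf_add]
    refine le_iInf₂ fun m hm => ?_
    rw [add_comm]
    exact sInf_le (IsString.trans hl hm)
  eq_of_edist_eq_zero {x y} h := by
    ext a
    have h1 : ENNReal.ofReal |x.coord a - y.coord a| / 2 ≤ edist x y := by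
      rw [edist_def]
      refine le_sInf fun l hl => ?_
      exact ENNReal.div_le_of_le_mul' (IsString.le_length hl a)
    rw [h, nonpos_iff_eq_zero, ENNReal.div_eq_zero_iff] at h1
    have h2 := ENNReal.ofReal_eq_zero.mp (h1.resolve_right (by simp))
    exact sub_eq_zero.mp (abs_nonpos_iff.mp h2)

end Realization

/-- The complex has dimension at most `2`. -/
def DimLETwo (K : AbstractSimplicialComplex V) : Prop :=
  ∀ s ∈ K, s.card ≤ 3

/-- Bounded geometry: there is a uniform bound on the number of simplices at a vertex. -/
def BoundedGeometry (K : AbstractSimplicialComplex V) : Prop :=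
  ∃ D : ℕ, ∀ a : V, {s : Finset V | s ∈ K ∧ a ∈ s}.encard ≤ D

open Classical in
/-- A simplicial map, given by its effect on vertices; it may collapse simplices. -/
structure SimplicialMap (K : AbstractSimplicialComplex V) (L : AbstractSimplicialComplex W) where
  /-- the map on vertices -/
  onVertices : V → W
  image_mem : ∀ s ∈ K, s.image onVertices ∈ L

namespace SimplicialMap

variable {K : AbstractSimplicialComplex V} {L : AbstractSimplicialComplex W}

/-- The map of realizations that is affine on each simplex. -/
def realize (g : SimplicialMap K L) (x : K.Realization) : L.Realization where
  coord := x.coord.mapDomain g.onVertices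
  nonneg b := by
    classical
    rw [Finsupp.mapDomain, Finsupp.sum_apply]
    refine Finset.sum_nonneg fun a _ => ?_
    simp only [Finsupp.single_apply]
    split_ifs
    · exact x.nonneg a
    · exact le_rfl
  sum_eq_one := by
    rw [Finsupp.sum_mapDomain_index (by intro; rfl) (by intros; rfl)]
    exact x.sum_eq_one
  support_mem := by
    classical
    have h := g.image_mem _ x.support_mem
    refine (L.isRelLowerSet_faces h).2 ?_ ?_
    · convert Finsupp.mapDomain_support (f := g.onVertices) (s := x.coord)
    · rw [Finsupp.support_nonempty_iff]
      intro h0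
      have h1 : (x.coord.mapDomain g.onVertices).sum (fun _ r => r) = 1 := by
        rw [Finsupp.sum_mapDomain_index (by intro; rfl) (by intros; rfl)]
        exact x.sum_eq_one
      rw [h0] at h1
      simp at h1

/-- The width: the maximal number of vertices in the preimage of a vertex. -/
def width (g : SimplicialMap K L) : ℕ∞ :=
  ⨆ b : W, (g.onVertices ⁻¹' {b}).encard

/-- `R`-width-visibility: every closed `R`-ball about a vertex contains `width g` distinct vertices
with the same image. -/
def IsWidthVisibleWith (g : SimplicialMap K L) (R : ℝ≥0) : Prop :=
  ∀ a : V, ∃ Y : Finset V, (Y.card : ℕ∞) = g.width ∧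
    (∀ y ∈ Y, K.vertex y ∈ Metric.closedEBall (K.vertex a) R) ∧
    ∃ b : W, ∀ y ∈ Y, g.onVertices y = b

/-- Width-visibility, for some positive radius. -/
def IsWidthVisible (g : SimplicialMap K L) : Prop :=
  ∃ R : ℝ≥0, 0 < R ∧ g.IsWidthVisibleWith R

end SimplicialMap

end AbstractSimplicialComplex

/-! ### Coarse notions for maps between (extended) metric spaces -/

namespace Coarse

variable {X : Type u} {Y : Type v} [PseudoEMetricSpace X] [PseudoEMetricSpace Y]

/-- `f` is `(κ, ε)`-coarsely Lipschitz. -/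
def IsCoarselyLipschitzWith (κ ε : ℝ≥0) (f : X → Y) : Prop :=
  ∀ x x' : X, edist (f x) (f x') ≤ κ * edist x x' + ε

/-- `f` is `κ`-regular: `(κ, κ)`-coarsely Lipschitz, and preimages of balls of radius `1` are
covered by `κ` balls of radius `1`. -/
def IsRegularWith (κ : ℝ≥0) (f : X → Y) : Prop :=
  IsCoarselyLipschitzWith κ κ f ∧
    ∀ y : Y, ∃ t : Finset X, (t.card : ℝ≥0) ≤ κ ∧
      f ⁻¹' Metric.closedEBall y 1 ⊆ ⋃ x ∈ t, Metric.closedEBall x 1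

/-- `f` is regular. -/
def IsRegular (f : X → Y) : Prop :=
  ∃ κ : ℝ≥0, 1 ≤ κ ∧ IsRegularWith κ f

/-- `f` is a `(κ, ε)`-quasi-isometry: a `(κ, ε)`-quasi-isometric embedding whose image is
`ε`-dense. -/
def IsQuasiIsometryWith (κ ε : ℝ≥0) (f : X → Y) : Prop :=
  (∀ x x' : X, (κ : ℝ≥0∞)⁻¹ * edist x x' ≤ edist (f x) (f x') + ε) ∧
    IsCoarselyLipschitzWith κ ε f ∧
    ∀ y : Y, ∃ x : X, edist (f x) y ≤ ε

/-- `f` is a quasi-isometry. -/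
def IsQuasiIsometry (f : X → Y) : Prop :=
  ∃ κ ε : ℝ≥0, 1 ≤ κ ∧ IsQuasiIsometryWith κ ε f

/-- `f'` is an `ε`-local modification of `f` at `x₀`: a continuous map agreeing with `f` outside
the `ε`-ball about `x₀`. -/
def IsLocalModification (ε : ℝ≥0) (x₀ : X) (f f' : X → Y) : Prop :=
  Continuous f' ∧ ∀ x : X, x ∉ Metric.closedEBall x₀ (ε : ℝ≥0∞) → f' x = f x

/-- `f` is `ε`-stable at `x₀`: every `ε`-local modification at `x₀` still covers `f x₀`. -/
def IsStableAt (ε : ℝ≥0) (f : X → Y) (x₀ : X) : Prop :=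
  ∀ f' : X → Y, IsLocalModification ε x₀ f f' → f x₀ ∈ Set.range f'

/-- `f` is very stable at `x₀`: it is `ε`-stable there for all `ε > 0`. -/
def IsVeryStableAt (f : X → Y) (x₀ : X) : Prop :=
  ∀ ε : ℝ≥0, 0 < ε → IsStableAt ε f x₀

/-- `f` is very stable, that is, very stable at some point. -/
def IsVeryStable (f : X → Y) : Prop :=
  ∃ x₀ : X, IsVeryStableAt f x₀

end Coarse

end

/-!
Write `f : X → ℍ` for the map under consideration. The argument rests on continuous maps
`h : ℍ → ℍ` which are the identity outside a ball and under which a point `b` has no preimage other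
than `a`; the radius of the ball depends on `dist a b` only
(`UpperHalfPlane.exists_continuous_move_of_dist_le`).

*Surjectivity.* Let `f'` be continuous and agree with `f` off the preimage of a bounded set. If `f'`
missed a point `q`, then `h ∘ f'` with `a = q`, `b = f x₀` would miss `f x₀`. By regularity,
preimages of bounded sets are bounded, so this would be a local modification of `f` at `x₀`,
contradicting stability. Hence all such `f'`, among them `f`, are surjective
(`Coarse.IsVeryStable.surjective_of_eq_off_closedBall`).

*Bounded fibres.* The vertices which width-visibility provides near `x` are as many as the width
allows, so they form the whole fibre over a vertex `v`, and `f` maps only points near `x` to `v`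
(`IsWidthVisible.exists_hasBoundedFibres`).

*Points with close images are close.* Let `f x` and `f x'` be close, and choose `v` and `v'` for them
as above. The preimage of a ball of bounded radius about `v` is covered by a bounded number of unit
balls, so some sphere about `x` of bounded radius avoids it. If `x'` were far outside that sphere,
then the map equal to `f` inside the sphere and to `h ∘ f` outside, where `h` moves `v` to `v'`, would
be continuous, would agree with `f` off a bounded set and would miss `v'`: inside the sphere there is
no point over `v'`, and outside there is none over `v`
(`Coarse.exists_edist_le_of_dist_le`).

*Linear bound.* As `f` is surjective, points along a geodesic of `ℍ` lift to `X`, and the bound for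
images at distance at most `1` adds up (`Coarse.IsRegular.isQuasiIsometry`).
-/

/-! ### Moving points in the hyperbolic plane -/

/-- Two points of a normed space can be moved to one another by a continuous map supported in a
ball: the displacement `b - a` is damped linearly with the distance to `a`. -/
theorem exists_continuous_move {E : Type*} [NormedAddCommGroup E] [NormedSpace ℝ E] {a b : E}
    {r : ℝ} (hr : ‖b - a‖ < r) :
    ∃ h : E → E, Continuous h ∧ (∀ z, r < ‖z - a‖ → h z = z) ∧ ∀ z, h z = b → z = a := by
  have hr0 : 0 < r := (norm_nonneg _).trans_lt hr
  refine ⟨fun z => z + max 0 (1 - ‖z - a‖ / r) • (b - a), by fun_prop, fun z hz => ?_,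
    fun z hz => ?_⟩
  · have : 1 - ‖z - a‖ / r ≤ 0 := by
      rw [sub_nonpos, one_le_div hr0]
      exact hz.le
    simp [max_eq_left this]
  · dsimp only at hz
    rcases le_total (1 - ‖z - a‖ / r) 0 with h | h
    · rw [max_eq_left h, zero_smul, add_zero] at hz
      rw [sub_nonpos, one_le_div hr0, hz] at h
      exact absurd h hr.not_ge
    · rw [max_eq_right h] at hz
      have h1 : z - a = (‖z - a‖ / r) • (b - a) := by
        rw [sub_smul, one_smul] at hz
        rw [← sub_eq_zero, ← sub_eq_zero.mpr hz]
        abel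
      have h2 : ‖z - a‖ = ‖z - a‖ / r * ‖b - a‖ := by
        conv_lhs => rw [h1]
        rw [norm_smul, Real.norm_of_nonneg (by positivity)]
      by_contra hne
      have h3 : 0 < ‖z - a‖ := norm_pos_iff.mpr (sub_ne_zero.mpr hne)
      have h4 : ‖z - a‖ / r * ‖b - a‖ < ‖z - a‖ / r * r := by gcongr
      rw [div_mul_cancel₀ _ hr0.ne'] at h4
      linarith

namespace UpperHalfPlane

open Metric

theorem exists_isometryEquiv_apply_eq (a b : ℍ) : ∃ e : ℍ ≃ᵢ ℍ, e a = b := by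
  obtain ⟨m, hm⟩ := MulAction.exists_smul_eq (Matrix.SpecialLinearGroup (Fin 2) ℝ) a b
  exact ⟨IsometryEquiv.constSMul m, hm⟩

/-- The coordinates `(re z, log (im z))`. -/
noncomputable def homeomorphProd : ℍ ≃ₜ ℝ × ℝ where
  toFun z := (z.re, Real.log z.im)
  invFun p := ⟨⟨p.1, Real.exp p.2⟩, Real.exp_pos _⟩
  left_inv z := by
    ext1
    apply Complex.ext
    · rfl
    · exact Real.exp_log z.im_pos
  right_inv p := by
    ext
    · rfl
    · exact Real.log_exp _
  continuous_toFun := continuous_re.prodMk (continuous_im.log fun z => z.im_ne_zero)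
  continuous_invFun := by
    refine isEmbedding_coe.continuous_iff.mpr ?_
    have h : Continuous fun p : ℝ × ℝ => Complex.equivRealProdCLM.symm (p.1, Real.exp p.2) := by
      fun_prop
    exact h

/-- The number of unit balls needed to cover a ball is bounded in terms of the radius only, since
the plane is homogeneous. -/
theorem exists_card_cover_closedBall_le (D : ℝ) :
    ∃ M : ℕ, ∀ a : ℍ, ∃ t : Finset ℍ, t.card ≤ M ∧
      closedBall a D ⊆ ⋃ c ∈ t, closedEBall c 1 := by
  classical
  obtain ⟨t, -, htf, ht⟩ := (isCompact_closedBall (I : ℍ) D).finite_cover_balls one_pos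
  refine ⟨htf.toFinset.card, fun a => ?_⟩
  obtain ⟨e, he⟩ := exists_isometryEquiv_apply_eq a I
  refine ⟨htf.toFinset.image e.symm, Finset.card_image_le, fun z hz => ?_⟩
  have h1 : e z ∈ closedBall (I : ℍ) D := by
    rw [mem_closedBall, ← he, e.dist_eq]
    exact hz
  obtain ⟨c, hc, hzc⟩ := Set.mem_iUnion₂.mp (ht h1)
  refine Set.mem_iUnion₂.mpr ⟨e.symm c, Finset.mem_image_of_mem _ (htf.mem_toFinset.mpr hc), ?_⟩
  rw [mem_closedEBall, ← e.edist_eq, e.apply_symm_apply, edist_dist]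
  exact ENNReal.ofReal_le_one.mpr (mem_ball.mp hzc).le

/-- Points at distance at most `D` can be moved to one another by a continuous map of the plane
which is the identity outside a ball whose radius depends on `D` only. -/
theorem exists_continuous_move_of_dist_le (D : ℝ) :
    ∃ D' : ℝ, ∀ a b : ℍ, dist a b ≤ D → ∃ h : ℍ → ℍ, Continuous h ∧
      (∀ z, D' < dist z a → h z = z) ∧ ∀ z, h z = b → z = a := by
  -- By homogeneity `a = I`; there, the coordinates turn the problem into one in the plane `ℝ × ℝ`.
  let ψ := homeomorphProd
  obtain ⟨r, hr⟩ := ((isCompact_closedBall (I : ℍ) D).image ψ.continuous).isBounded.subset_ball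
    (ψ I)
  obtain ⟨D', hD'⟩ :=
    ((isCompact_closedBall (ψ I) r).image ψ.symm.continuous).isBounded.subset_closedBall (I : ℍ)
  refine ⟨D', fun a b hab => ?_⟩
  obtain ⟨e, he⟩ := exists_isometryEquiv_apply_eq a I
  have h1 : ‖ψ (e b) - ψ I‖ < r := by
    rw [← dist_eq_norm]
    refine hr ⟨e b, ?_, rfl⟩
    rw [mem_closedBall, ← he, e.dist_eq, dist_comm]
    exact hab
  obtain ⟨h, hc, hid, hinj⟩ := exists_continuous_move h1
  refine ⟨fun z => e.symm (ψ.symm (h (ψ (e z)))), ?_, fun z hz => ?_, fun z hz => ?_⟩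
  · exact e.symm.continuous.comp (ψ.symm.continuous.comp (hc.comp (ψ.continuous.comp e.continuous)))
  · have h2 : h (ψ (e z)) = ψ (e z) := by
      refine hid _ (not_le.mp fun hle => hz.not_ge ?_)
      have h3 : e z ∈ closedBall (I : ℍ) D' :=
        hD' ⟨ψ (e z), by rwa [mem_closedBall, dist_eq_norm], ψ.symm_apply_apply _⟩
      rwa [mem_closedBall, ← he, e.dist_eq] at h3
    simp [h2]
  · have h2 : h (ψ (e z)) = ψ (e b) := by
      rw [← hz]
      simp
    have h3 := hinj _ h2
    exact e.injective ((ψ.injective h3).trans he.symm)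

/-- Closed balls intersect as soon as the sum of their radii is at least the distance of their
centers. Hyperbolic balls being Euclidean ones, this reduces to the same fact in `ℂ`. -/
theorem exists_dist_le_le {p q : ℍ} {r s : ℝ} (hr : 0 ≤ r) (hs : 0 ≤ s) (h : dist p q ≤ r + s) :
    ∃ m : ℍ, dist m p ≤ r ∧ dist m q ≤ s := by
  have hsr : 0 ≤ Real.sinh r := Real.sinh_nonneg_iff.mpr hr
  have hss : 0 ≤ Real.sinh s := Real.sinh_nonneg_iff.mpr hs
  have hcosh : Real.cosh (dist p q) ≤ Real.cosh (r + s) := by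
    rw [Real.cosh_le_cosh, abs_of_nonneg dist_nonneg, abs_of_nonneg (add_nonneg hr hs)]
    exact h
  rw [cosh_dist', div_le_iff₀ (by positivity), Real.cosh_add] at hcosh
  have hdist : dist (p.center r : ℂ) (q.center s) ≤ q.im * Real.sinh s + p.im * Real.sinh r := by
    refine abs_le_of_sq_le_sq' ?_ (by positivity) |>.2
    rw [Complex.dist_eq, Complex.sq_norm, Complex.normSq_apply]
    simp only [Complex.sub_re, Complex.sub_im, coe_re, coe_im, center_re, center_im]
    have h1 := Real.cosh_sq r
    have h2 := Real.cosh_sq s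
    nlinarith
  obtain ⟨w, hw1, hw2⟩ := _root_.exists_dist_le_le (mul_nonneg p.im_pos.le hsr)
    (mul_nonneg q.im_pos.le hss) hdist
  rw [dist_comm] at hw1
  lift w to ℍ using im_pos_of_dist_center_le hw1
  exact ⟨w, dist_le_iff_dist_coe_center_le.mpr hw1, dist_le_iff_dist_coe_center_le.mpr hw2⟩

end UpperHalfPlane

/-! ### Stable regular maps to the hyperbolic plane -/

/-- Being at finite distance is an open equivalence relation. -/
theorem edist_ne_top_of_connectedSpace {X : Type*} [PseudoEMetricSpace X] [ConnectedSpace X]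
    (x y : X) : edist x y ≠ ⊤ := by
  have hclosed : IsClosed (Metric.eball y ⊤) := by
    refine isOpen_compl_iff.mp (EMetric.isOpen_iff.mpr fun z hz => ⟨1, one_pos, fun w hw hwy => ?_⟩)
    refine hz ((edist_triangle_left z y w).trans_lt (ENNReal.add_lt_top.mpr ⟨?_, hwy⟩))
    exact (Metric.mem_eball.mp hw).trans ENNReal.one_lt_top
  have h := IsClopen.eq_univ ⟨hclosed, Metric.isOpen_eball⟩ ⟨y, by simp⟩
  have hx : x ∈ Metric.eball y ⊤ := h ▸ Set.mem_univ x
  exact (Metric.mem_eball.mp hx).ne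

namespace Coarse

open Metric UpperHalfPlane

variable {X : Type*} [PseudoEMetricSpace X] {f : X → ℍ}

theorem IsRegular.exists_card_cover_preimage_closedBall_le (hreg : IsRegular f) (D : ℝ) :
    ∃ M : ℕ, ∀ a : ℍ, ∃ t : Finset X, t.card ≤ M ∧
      f ⁻¹' closedBall a D ⊆ ⋃ x ∈ t, closedEBall x 1 := by
  classical
  obtain ⟨κ, -, -, hκ⟩ := hreg
  choose T hT hcov using hκ
  obtain ⟨M, hM⟩ := exists_card_cover_closedBall_le D
  refine ⟨M * ⌊κ⌋₊, fun a => ?_⟩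
  obtain ⟨t, ht, hta⟩ := hM a
  refine ⟨t.biUnion T, ?_, fun x hx => ?_⟩
  · exact (Finset.card_biUnion_le_card_mul _ _ _ fun c _ => Nat.le_floor (hT c)).trans (by gcongr)
  · obtain ⟨c, hc, hxc⟩ := Set.mem_iUnion₂.mp (hta hx)
    obtain ⟨y, hy, hxy⟩ := Set.mem_iUnion₂.mp (hcov c hxc)
    exact Set.mem_iUnion₂.mpr ⟨y, Finset.mem_biUnion.mpr ⟨c, hc, hy⟩, hxy⟩

theorem IsRegular.exists_preimage_closedBall_subset [ConnectedSpace X] (hreg : IsRegular f)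
    (a : ℍ) (D : ℝ) (x₀ : X) :
    ∃ ε : ℝ≥0, 0 < ε ∧ f ⁻¹' closedBall a D ⊆ closedEBall x₀ ε := by
  obtain ⟨M, hM⟩ := hreg.exists_card_cover_preimage_closedBall_le D
  obtain ⟨t, -, ht⟩ := hM a
  refine ⟨1 + t.sup fun c => (edist c x₀).toNNReal, by positivity, fun x hx => ?_⟩
  obtain ⟨c, hc, hxc⟩ := Set.mem_iUnion₂.mp (ht hx)
  rw [mem_closedEBall, ENNReal.coe_add, ENNReal.coe_one]
  refine (edist_triangle x c x₀).trans (add_le_add hxc ?_)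
  rw [← ENNReal.coe_toNNReal (edist_ne_top_of_connectedSpace c x₀)]
  exact ENNReal.coe_le_coe.mpr (Finset.le_sup (f := fun c => (edist c x₀).toNNReal) hc)

/-- If a modification of `f` over a bounded set missed a point `q`, then moving `q` to `f x₀` would
yield a local modification at `x₀` missing `f x₀`; it is local since, by regularity, preimages of
bounded sets are bounded. -/
theorem IsVeryStable.surjective_of_eq_off_closedBall [ConnectedSpace X] (hstab : IsVeryStable f)
    (hreg : IsRegular f) {f' : X → ℍ} (hf' : Continuous f') (a : ℍ) (D : ℝ)
    (h : ∀ x, D < dist (f x) a → f' x = f x) : Function.Surjective f' := by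
  intro q
  by_contra hq
  obtain ⟨x₀, hx₀⟩ := hstab
  obtain ⟨D', hD'⟩ := exists_continuous_move_of_dist_le (dist q (f x₀))
  obtain ⟨m, hmc, hmid, hm⟩ := hD' q (f x₀) le_rfl
  obtain ⟨ε, hε, hsub⟩ := hreg.exists_preimage_closedBall_subset a (max D (D' + dist q a)) x₀
  obtain ⟨x, hx⟩ := hx₀ ε hε (fun x => m (f' x)) ⟨hmc.comp hf', fun x hx => by
    have h1 : max D (D' + dist q a) < dist (f x) a := not_le.mp fun hle => hx (hsub hle)
    obtain ⟨h2, h3⟩ := max_lt_iff.mp h1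
    have h4 := dist_triangle (f x) q a
    change m (f' x) = f x
    rw [h x h2]
    exact hmid _ (by linarith)⟩
  exact hq ⟨x, hm _ hx⟩

/-- Some sphere about `x` of a radius between `S` and `S + 3 * M` avoids a set covered by `M` unit
balls. -/
theorem exists_edist_ne_of_card_cover_le {A : Set X} {t : Finset X} {M : ℕ} (ht : t.card ≤ M)
    (hA : A ⊆ ⋃ c ∈ t, closedEBall c 1) (S : ℝ≥0) (x : X) :
    ∃ r : ℝ≥0, S ≤ r ∧ r ≤ S + 3 * M ∧ ∀ z ∈ A, edist x z ≠ r := by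
  -- A unit ball meets at most one of the spheres of radii `S + 3 * j`, `j = 0, …, M`.
  by_contra! hcon
  have hex (j : Fin (M + 1)) : ∃ z ∈ A, edist x z = ((S + 3 * (j : ℕ) : ℝ≥0) : ℝ≥0∞) := by
    refine hcon _ le_self_add ?_
    gcongr
    exact_mod_cast Nat.lt_succ_iff.mp j.2
  choose z hzA hz using hex
  choose c hct hc using fun j => Set.mem_iUnion₂.mp (hA (hzA j))
  obtain ⟨i, -, j, -, hij, hcij⟩ := Finset.exists_ne_map_eq_of_card_lt_of_maps_to
    (s := Finset.univ) (t := t) (f := c) (by simpa using Nat.lt_succ_of_le ht) (fun j _ => hct j)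
  have key (i j : Fin (M + 1)) (hcij : c i = c j) : ¬ i < j := by
    intro hlt
    have h1 : edist x (z j) ≤ edist x (z i) + (1 + 1) := by
      refine (edist_triangle x (z i) (z j)).trans (add_le_add le_rfl ?_)
      refine (edist_triangle_right _ _ (c i)).trans (add_le_add (hc i) ?_)
      rw [hcij]
      exact hc j
    rw [hz, hz] at h1
    have h2 : S + 3 * ((j : ℕ) : ℝ≥0) ≤ S + 3 * ((i : ℕ) : ℝ≥0) + (1 + 1) := by exact_mod_cast h1
    have h3 : ((i : ℕ) : ℝ) + 1 ≤ (j : ℕ) := by exact_mod_cast hlt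
    have h4 : (S : ℝ) + 3 * ((j : ℕ) : ℝ) ≤ S + 3 * ((i : ℕ) : ℝ) + (1 + 1) := by exact_mod_cast h2
    linarith
  rcases lt_or_gt_of_ne hij with hlt | hlt
  · exact key i j hcij hlt
  · exact key j i hcij.symm hlt

/-- Within distance `S` of every value `f x` there is a point `v` whose whole fibre lies in the
`S`-ball about `x`. The fibre may be empty. -/
def HasBoundedFibres (S : ℝ≥0) (f : X → ℍ) : Prop :=
  ∀ x : X, ∃ v : ℍ, dist (f x) v ≤ S ∧ f ⁻¹' {v} ⊆ closedEBall x S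

/-- Let `v` and `v'` be close to `f x` and `f x'` and have fibres close to `x` and `x'`. If `x` and
`x'` are far apart, then a sphere about `x` that avoids the preimage of a ball about `v` separates
these two fibres. Composing `f` outside the sphere with a move of `v` to `v'` is a modification that
misses `v'`, against the stability of `f`. -/
theorem exists_edist_le_of_dist_le [ConnectedSpace X] (hf : Continuous f) (hreg : IsRegular f)
    (hstab : IsVeryStable f) {S : ℝ≥0} (hfib : HasBoundedFibres S f) (D : ℝ) :
    ∃ L : ℝ≥0, ∀ x x' : X, dist (f x) (f x') ≤ D → edist x x' ≤ L := by
  classical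
  obtain ⟨D', hD'⟩ := exists_continuous_move_of_dist_le (S + D + S)
  obtain ⟨M, hM⟩ := hreg.exists_card_cover_preimage_closedBall_le D'
  refine ⟨S + 3 * M + S, fun x x' hxx' => ?_⟩
  obtain ⟨v, hxv, hv⟩ := hfib x
  obtain ⟨v', hxv', hv'⟩ := hfib x'
  obtain ⟨m, hmc, hmid, hm⟩ := hD' v v' <| by
    rw [dist_comm] at hxv
    exact (dist_triangle4 v (f x) (f x') v').trans (by gcongr)
  obtain ⟨t, ht, htv⟩ := hM v
  -- On the sphere of radius `r` about `x`, `f` stays in the region where `m` is the identity, so that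
  -- the two halves of `f'` fit together.
  obtain ⟨r, hSr, hrM, hr⟩ := exists_edist_ne_of_card_cover_le ht htv S x
  let f' : X → ℍ := fun z => if edist x z ≤ r then f z else m (f z)
  have hcont : Continuous f' := by
    refine hf.if_le (hmc.comp hf) (continuous_const.edist continuous_id) continuous_const
      fun z hz => ?_
    exact (hmid _ (not_le.mp fun hle => hr z hle hz)).symm
  obtain ⟨z, hz⟩ := hstab.surjective_of_eq_off_closedBall hreg hcont v D' (fun z hz => by
    simp [f', hmid _ hz]) v'
  by_cases hzr : edist x z ≤ r
  · have h1 : f z = v' := by simpa [f', hzr] using hz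
    calc edist x x' ≤ edist x z + edist z x' := edist_triangle _ _ _
      _ ≤ r + S := add_le_add hzr (hv' h1)
      _ ≤ _ := by exact_mod_cast add_le_add hrM le_rfl
  · have h1 : m (f z) = v' := by simpa [f', hzr] using hz
    have h2 : edist z x ≤ S := hv (hm _ h1)
    rw [edist_comm] at h2
    exact absurd (h2.trans (ENNReal.coe_le_coe.mpr hSr)) hzr

/-- A regular and very stable map with bounded fibres is a quasi-isometry. Since `f` is surjective
and the plane is geodesic, the bound for points with images at distance at most `1` propagates to a
linear bound. -/
theorem IsRegular.isQuasiIsometry [ConnectedSpace X] (hf : Continuous f) (hreg : IsRegular f)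
    (hstab : IsVeryStable f) {S : ℝ≥0} (hfib : HasBoundedFibres S f) : IsQuasiIsometry f := by
  have hsurj : Function.Surjective f :=
    hstab.surjective_of_eq_off_closedBall hreg hf I 0 fun _ _ => rfl
  obtain ⟨L, hL⟩ := exists_edist_le_of_dist_le hf hreg hstab hfib 1
  have hchain (n : ℕ) : ∀ x x' : X, dist (f x) (f x') ≤ n → edist x x' ≤ (n + 1) * L := by
    induction n with
    | zero =>
      intro x x' h
      rw [Nat.cast_zero] at h
      simpa using hL x x' (h.trans zero_le_one)
    | succ n ih =>
      intro x x' h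
      push_cast at h
      obtain ⟨p, hp, hp'⟩ := UpperHalfPlane.exists_dist_le_le n.cast_nonneg zero_le_one h
      obtain ⟨y, rfl⟩ := hsurj p
      rw [dist_comm] at hp
      calc edist x x' ≤ edist x y + edist y x' := edist_triangle _ _ _
        _ ≤ (n + 1) * L + L := add_le_add (ih _ _ hp) (hL _ _ hp')
        _ = _ := by push_cast; ring
  obtain ⟨κ, hκ1, hκ, -⟩ := hreg
  refine ⟨max κ L, max κ 2, le_max_of_le_left hκ1, fun x x' => ?_, fun x x' => ?_, fun y => ?_⟩
  · have hpos : 0 < max κ L := one_pos.trans_le (le_max_of_le_left hκ1)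
    rw [ENNReal.inv_mul_le_iff (by exact_mod_cast hpos.ne') ENNReal.coe_ne_top]
    have hn : (⌈dist (f x) (f x')⌉₊ : ℝ≥0∞) ≤ edist (f x) (f x') + 1 := by
      rw [edist_dist, ← ENNReal.ofReal_one, ← ENNReal.ofReal_add dist_nonneg zero_le_one,
        ← ENNReal.ofReal_natCast]
      exact ENNReal.ofReal_le_ofReal (Nat.ceil_lt_add_one dist_nonneg).le
    calc edist x x' ≤ (⌈dist (f x) (f x')⌉₊ + 1) * L := hchain _ _ _ (Nat.le_ceil _)
      _ ≤ (edist (f x) (f x') + 1 + 1) * L := by gcongr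
      _ = L * (edist (f x) (f x') + 2) := by rw [add_assoc, one_add_one_eq_two, mul_comm]
      _ ≤ _ := by
        gcongr
        · exact le_max_right _ _
        · exact_mod_cast le_max_right κ 2
  · refine (hκ x x').trans ?_
    gcongr <;> exact le_max_left _ _
  · obtain ⟨x, rfl⟩ := hsurj y
    exact ⟨x, by simp⟩

end Coarse

/-! ### Simplicial maps and their fibres -/

namespace AbstractSimplicialComplex

open Metric

variable {V W : Type*} {K : AbstractSimplicialComplex V} {L : AbstractSimplicialComplex W}

namespace Realization

theorem InCommonSimplex.edist_le {x y : K.Realization} (h : InCommonSimplex x y) :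
    edist x y ≤ ENNReal.ofReal (simplexDist x y) := by
  rw [edist_def]
  exact sInf_le (by simpa using IsString.cons h (IsString.nil y))

theorem coord_le_one (x : K.Realization) (a : V) : x.coord a ≤ 1 := by
  by_cases ha : a ∈ x.coord.support
  · rw [← x.sum_eq_one]
    exact Finset.single_le_sum (f := x.coord) (fun b _ => x.nonneg b) ha
  · rw [Finsupp.notMem_support_iff.mp ha]
    exact zero_le_one

/-- The squared coordinate differences are bounded by `x.coord a + y.coord a`, which sum to `2`. -/
theorem simplexDist_le_one (x y : K.Realization) : simplexDist x y ≤ 1 := by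
  classical
  refine Real.sqrt_le_one.mpr ((div_le_one two_pos).mpr ?_)
  have hsupp : (x.coord - y.coord).support ⊆ x.coord.support ∪ y.coord.support :=
    Finsupp.support_sub
  rw [Finsupp.sum_of_support_subset _ hsupp _ (by simp)]
  have hx := x.sum_eq_one
  have hy := y.sum_eq_one
  rw [Finsupp.sum_of_support_subset _ Finset.subset_union_left _ (by simp)] at hx
  rw [Finsupp.sum_of_support_subset _ Finset.subset_union_right _ (by simp)] at hy
  calc ∑ a ∈ x.coord.support ∪ y.coord.support, (x.coord - y.coord) a ^ 2
      ≤ ∑ a ∈ x.coord.support ∪ y.coord.support, (x.coord a + y.coord a) := by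
        refine Finset.sum_le_sum fun a _ => ?_
        rw [Finsupp.sub_apply]
        have h1 := x.nonneg a
        have h2 := y.nonneg a
        have h3 := x.coord_le_one a
        have h4 := y.coord_le_one a
        nlinarith [mul_nonneg h1 h2]
    _ = 2 := by rw [Finset.sum_add_distrib, hx, hy]; norm_num

theorem InCommonSimplex.edist_le_one {x y : K.Realization} (h : InCommonSimplex x y) :
    edist x y ≤ 1 :=
  h.edist_le.trans (ENNReal.ofReal_le_one.mpr (simplexDist_le_one x y))

theorem edist_vertex_le_one {x : K.Realization} {a : V} (ha : a ∈ x.coord.support) :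
    edist x (K.vertex a) ≤ 1 := by
  refine InCommonSimplex.edist_le_one ⟨_, x.support_mem, subset_rfl, ?_⟩
  exact Finsupp.support_single_subset.trans (Finset.singleton_subset_iff.mpr ha)

theorem support_nonempty (x : K.Realization) : x.coord.support.Nonempty := by
  rw [Finsupp.support_nonempty_iff]
  intro h
  simpa [h] using x.sum_eq_one

end Realization

namespace SimplicialMap

open Realization

theorem realize_vertex (g : SimplicialMap K L) (a : V) :
    g.realize (K.vertex a) = L.vertex (g.onVertices a) := by
  ext1
  exact Finsupp.mapDomain_single

theorem inCommonSimplex_realize (g : SimplicialMap K L) {x y : K.Realization}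
    (h : InCommonSimplex x y) : InCommonSimplex (g.realize x) (g.realize y) := by
  classical
  obtain ⟨s, hs, hx, hy⟩ := h
  refine ⟨s.image g.onVertices, by convert g.image_mem s hs, ?_, ?_⟩
  · exact Finsupp.mapDomain_support.trans (Finset.image_subset_image hx)
  · exact Finsupp.mapDomain_support.trans (Finset.image_subset_image hy)

/-- Each barycentric coordinate of the image is a sum of at most three coordinates, so that squares
grow at most by a factor of `3` by the Cauchy–Schwarz inequality. -/
theorem simplexDist_realize_le (hdim : K.DimLETwo) (g : SimplicialMap K L) {x y : K.Realization}
    (h : InCommonSimplex x y) :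
    simplexDist (g.realize x) (g.realize y) ≤ 2 * simplexDist x y := by
  classical
  obtain ⟨s, hs, hx, hy⟩ := h
  have hd : (x.coord - y.coord).support ⊆ s :=
    Finsupp.support_sub.trans (Finset.union_subset hx hy)
  have hmap : (g.realize x).coord - (g.realize y).coord
      = (x.coord - y.coord).mapDomain g.onVertices :=
    (map_sub (Finsupp.mapDomain.addMonoidHom g.onVertices) x.coord y.coord).symm
  unfold simplexDist
  rw [hmap]
  set d := x.coord - y.coord
  have happly (b : W) : d.mapDomain g.onVertices b = ∑ a ∈ s with g.onVertices a = b, d a := by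
    rw [Finsupp.mapDomain, Finsupp.sum_apply, Finsupp.sum_of_support_subset _ hd _ (by simp),
      Finset.sum_filter]
    exact Finset.sum_congr rfl fun a _ => Finsupp.single_apply
  have hsum : (d.mapDomain g.onVertices).sum (fun _ r => r ^ 2) ≤ 3 * d.sum fun _ r => r ^ 2 := by
    rw [Finsupp.sum_of_support_subset _
      (Finsupp.mapDomain_support.trans (Finset.image_subset_image hd)) _ (by simp),
      Finsupp.sum_of_support_subset _ hd _ (by simp)]
    calc ∑ b ∈ s.image g.onVertices, d.mapDomain g.onVertices b ^ 2
        ≤ ∑ b ∈ s.image g.onVertices, 3 * ∑ a ∈ s with g.onVertices a = b, d a ^ 2 := by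
          refine Finset.sum_le_sum fun b _ => ?_
          rw [happly]
          refine sq_sum_le_card_mul_sum_sq.trans ?_
          gcongr
          exact_mod_cast (Finset.card_filter_le _ _).trans (hdim s hs)
      _ = 3 * ∑ a ∈ s, d a ^ 2 := by
          rw [← Finset.mul_sum, Finset.sum_fiberwise_of_maps_to (g := g.onVertices)
            fun a ha => Finset.mem_image_of_mem _ ha]
  have hnonneg : 0 ≤ d.sum fun _ r => r ^ 2 := Finset.sum_nonneg fun a _ => sq_nonneg (d a)
  rw [Real.sqrt_le_left (by positivity), mul_pow, Real.sq_sqrt (by positivity)]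
  linarith

theorem lipschitzWith_realize (hdim : K.DimLETwo) (g : SimplicialMap K L) :
    LipschitzWith 2 g.realize := by
  intro x y
  have hstring {x y : K.Realization} {l : ℝ≥0∞} (h : IsString x y l) :
      edist (g.realize x) (g.realize y) ≤ 2 * l := by
    induction h with
    | nil x => simp
    | @cons x y z l hc _ ih =>
      refine (edist_triangle _ (g.realize y) _).trans ?_
      rw [mul_add]
      refine add_le_add ((g.inCommonSimplex_realize hc).edist_le.trans ?_) ih
      refine (ENNReal.ofReal_le_ofReal (simplexDist_realize_le hdim g hc)).trans_eq ?_
      rw [ENNReal.ofReal_mul two_pos.le, ENNReal.ofReal_ofNat]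
  rw [ENNReal.coe_ofNat, ← ENNReal.div_le_iff' (by simp) (by simp), edist_def x y]
  exact le_sInf fun l hl => ENNReal.div_le_of_le_mul' (hstring hl)

theorem onVertices_eq_of_realize_eq_vertex (g : SimplicialMap K L) {x : K.Realization} {b : W}
    (h : g.realize x = L.vertex b) {a : V} (ha : a ∈ x.coord.support) : g.onVertices a = b := by
  classical
  by_contra hne
  have h1 : x.coord.mapDomain g.onVertices (g.onVertices a) = 0 := by
    change (g.realize x).coord (g.onVertices a) = 0
    rw [h]
    exact Finsupp.single_eq_of_ne hne
  rw [Finsupp.mapDomain, Finsupp.sum_apply] at h1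
  have h2 := (Finset.sum_eq_zero_iff_of_nonneg fun c _ => by
    dsimp only
    rw [Finsupp.single_apply]
    split_ifs
    exacts [x.nonneg c, le_rfl]).mp h1 a ha
  dsimp only at h2
  rw [Finsupp.single_eq_same] at h2
  exact Finsupp.mem_support_iff.mp ha h2

/-- The vertices found near `a` exhaust the fibre over their common image, as their number is the
width. -/
theorem IsWidthVisibleWith.exists_fibre_subset {g : SimplicialMap K L} {R : ℝ≥0}
    (hvis : g.IsWidthVisibleWith R) (a : V) :
    ∃ b : W, (∃ y, g.onVertices y = b ∧ K.vertex y ∈ closedEBall (K.vertex a) R) ∧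
      ∀ y, g.onVertices y = b → K.vertex y ∈ closedEBall (K.vertex a) R := by
  obtain ⟨Y, hcard, hY, b, hb⟩ := hvis a
  have hYb : (Y : Set V) = g.onVertices ⁻¹' {b} := by
    refine Y.finite_toSet.eq_of_subset_of_encard_le hb ?_
    rw [Set.encard_coe_eq_coe_finsetCard, hcard]
    exact le_iSup (fun b : W => (g.onVertices ⁻¹' {b}).encard) b
  have hne : Y.Nonempty := by
    have h1 : 1 ≤ g.width := by
      refine le_trans ?_ (le_iSup (fun b : W => (g.onVertices ⁻¹' {b}).encard) (g.onVertices a))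
      exact Set.one_le_encard_iff_nonempty.mpr ⟨a, rfl⟩
    rw [← hcard] at h1
    exact Finset.card_pos.mp (by exact_mod_cast h1)
  obtain ⟨y, hy⟩ := hne
  refine ⟨b, ⟨y, hb y hy, hY y hy⟩, fun z hz => hY z ?_⟩
  rw [← Finset.mem_coe, hYb]
  exact hz

/-- A point with the same image as a vertex lies in a simplex which is collapsed to that image, so
it is within distance `1` of a vertex in the fibre. -/
theorem IsWidthVisible.exists_hasBoundedFibres {g : SimplicialMap K L}
    {φ : L.Realization → UpperHalfPlane} (hφ : Function.Injective φ) (hvis : g.IsWidthVisible)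
    (hreg : Coarse.IsRegular fun x : K.Realization => φ (g.realize x)) :
    ∃ S : ℝ≥0, Coarse.HasBoundedFibres S fun x : K.Realization => φ (g.realize x) := by
  obtain ⟨R, -, hR⟩ := hvis
  obtain ⟨κ, -, hκ, -⟩ := hreg
  refine ⟨max (κ * (1 + R) + κ) (1 + R + 1), fun x => ?_⟩
  obtain ⟨a, ha⟩ := x.support_nonempty
  obtain ⟨b, ⟨y, rfl, hy⟩, hb⟩ := hR.exists_fibre_subset a
  have hxy {y : V} (hy : K.vertex y ∈ closedEBall (K.vertex a) R) :
      edist x (K.vertex y) ≤ 1 + R := by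
    rw [mem_closedEBall'] at hy
    exact (edist_triangle _ _ _).trans (add_le_add (edist_vertex_le_one ha) hy)
  refine ⟨φ (L.vertex (g.onVertices y)), ?_, fun z hz => ?_⟩
  · rw [← g.realize_vertex, dist_nndist, NNReal.coe_le_coe, ← ENNReal.coe_le_coe, ← edist_nndist]
    refine (hκ x (K.vertex y)).trans ?_
    calc κ * edist x (K.vertex y) + κ ≤ κ * (1 + R) + κ := by gcongr; exact hxy hy
      _ ≤ _ := by exact_mod_cast le_max_left (κ * (1 + R) + κ) (1 + R + 1)
  · obtain ⟨c, hc⟩ := z.support_nonempty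
    have h1 := hxy (hb c (g.onVertices_eq_of_realize_eq_vertex (hφ hz) hc))
    rw [edist_comm] at h1
    have h2 := (edist_triangle z (K.vertex c) x).trans (add_le_add (edist_vertex_le_one hc) h1)
    refine h2.trans ?_
    rw [add_comm]
    exact_mod_cast le_max_right (κ * (1 + R) + κ) (1 + R + 1)

end SimplicialMap

end AbstractSimplicialComplex

/-! ### Quasi-isometry -/

/-- `X` is a simplicial complex of dimension at most `2`, connected and of bounded geometry; `P` is
a triangulation of the hyperbolic plane `ℍ` by way of the homeomorphism `φ`; and `g` is a simplicial
map from `X` to `P`, considered as the map `φ ∘ g.realize` into `ℍ` with its hyperbolic metric. -/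
theorem mainTheorem8 {V : Type*} {W : Type*}
    (X : AbstractSimplicialComplex V) (hdim : X.DimLETwo) (hgeom : X.BoundedGeometry)
    (hconn : ConnectedSpace X.Realization)
    (P : AbstractSimplicialComplex W) (φ : P.Realization ≃ₜ UpperHalfPlane)
    (g : AbstractSimplicialComplex.SimplicialMap X P)
    (hreg : Coarse.IsRegular (fun x : X.Realization => φ (g.realize x)))
    (hvis : g.IsWidthVisible)
    (hstab : Coarse.IsVeryStable (fun x : X.Realization => φ (g.realize x))) :
    Coarse.IsQuasiIsometry (fun x : X.Realization => φ (g.realize x)) := by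
  obtain ⟨S, hS⟩ := hvis.exists_hasBoundedFibres φ.injective hreg
  exact hreg.isQuasiIsometry (φ.continuous.comp (g.lipschitzWith_realize hdim).continuous) hstab hS
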